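/- Let $U$ be the group of upper triangular unipotent $3\times3$ matrices, $\Gamma_\infty=U(\mathbb Z)$, $w_0=\left(\begin{smallmatrix}&&1\\&-1&\\1&&\end{smallmatrix}\right)$, $t(c_1,c_2)=\operatorname{diag}(c_1,c_2/c_1,1/c_2)$ for nonzero integers $c_1,c_2$, and $e(x)=e^{2\pi i x}$. For $m=(m_1,m_2)\in\mathbb Z^2$ and $u\in U(\mathbb R)$ let $\psi_m(u)=e(m_1u_{12}+m_2u_{23})$. For nonzero integers $d_1,d_2$ and a positive integer $f$ put $$\Omega(d_1,d_2,f)=\left\{A\in SL_3(\mathbb Z):\ \gcd(A_{31},A_{32})=f,\ A_{31}=d_1f,\ A_{21}A_{32}-A_{22}A_{31}=d_2f\right\},$$ and let $\Omega_{w_0}(c_1,c_2)$ be the set of $A\in SL_3(\mathbb Z)$ of the form $A=u_Lw_0t(c_1,c_2)u_R$ with $u_L,u_R\in U(\mathbb R)$. Such $u_L,u_R$ are unique, and $\psi_m(u_L)\psi_n(u_R)$ depends only on $\Gamma_\infty A\Gamma_\infty$. The fine and coarse long-word Kloosterman sums are $$\mathscr S_{w_0}(m,n;d_1,d_2,f)=\sum_{\substack{A\in\Gamma_\infty\backslash\Omega(d_1,d_2,f)/\Gamma_\infty\\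 A=u_Lw_0t(d_1f,d_2f)u_R}}\psi_m(u_L)\psi_n(u_R),\qquad S_{w_0}(m,n;(c_1,c_2))=\sum_{\substack{A\in\Gamma_\infty\backslash\Omega_{w_0}(c_1,c_2)/\Gamma_\infty\\ A=u_Lw_0t(c_1,c_2)u_R}}\psi_m(u_L)\psi_n(u_R),$$ and the classical Kloosterman sum is, for integers $a,b$ and $c\neq0$, $S(a,b;c)=\sum_{x,y \bmod c,\ xy\equiv1 (c)}e\!\left(\frac{ax+by}{c}\right)$. **Theorem.** Let $m_1,m_2,n_1,n_2\in\mathbb Z$, $m=(m_1,m_2)$, $n=(n_1,n_2)$. 1. Let $d_1,d_2$ be nonzero integers and $f$ a positive integer. The set $\Gamma_\infty\backslash\Omega(d_1,d_2,f)/\Gamma_\infty$ is finite. If $\gcd(m_2d_2,f)\ne\gcd(n_2d_1,f)$, then $\mathscr S_{w_0}(m,n;d_1,d_2,f)=0$. If $\gcd(m_2d_2,f)=\gcd(n_2d_1,f)$, then $$\mathscr S_{w_0}(m,n;d_1,d_2,f)=f\sum_{\substack{x_3,y_3\bmod f\\ x_3y_3\equiv1\ (f)\\ m_2d_2+n_2d_1y_3\equiv0\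 (f)}}S\!\left(n_1,\tfrac{m_2d_2+n_2d_1y_3}{f};d_1\right)S\!\left(m_1,\tfrac{n_2d_1+m_2d_2x_3}{f};d_2\right).$$ 2. Let $c_1,c_2$ be nonzero integers. The set $\Gamma_\infty\backslash\Omega_{w_0}(c_1,c_2)/\Gamma_\infty$ is finite, and $$S_{w_0}(m,n;(c_1,c_2))=\sum_{\substack{f\mid\gcd(c_1,c_2)\\ f>0}}\mathscr S_{w_0}\!\left(m,n;\tfrac{c_1}{f},\tfrac{c_2}{f},f\right).$$ Consequently, with $d_1=c_1/f$ and $d_2=c_2/f$ in each term, $$S_{w_0}(m,n;(c_1,c_2))=\sum_{\substack{f\mid\gcd(c_1,c_2)\\ f>0}}f\sum_{\substack{x_3,y_3\bmod f\\ x_3y_3\equiv1\ (f)\\ m_2d_2+n_2d_1y_3\equiv0\ (f)}}S\!\left(n_1,\tfrac{m_2d_2+n_2d_1y_3}{f};d_1\right)S\!\left(m_1,\tfrac{n_2d_1+m_2d_2x_3}{f};d_2\right).$$ -/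

import Mathlib

open Matrix

/-- The group `U(R)` of upper triangular `3 × 3` matrices over `R` with ones on the diagonal,
as a subgroup of `SL₃(R)`. -/
def unipotent (R : Type*) [CommRing R] : Subgroup (SpecialLinearGroup (Fin 3) R) where
  carrier := {u | (∀ i, u i i = 1) ∧ ∀ i j, j < i → u i j = 0}
  one_mem' := by
    refine ⟨fun i => by simp, fun i j h => ?_⟩
    simp [h.ne']
  mul_mem' := by
    rintro a b ⟨ha, ha'⟩ ⟨hb, hb'⟩
    have a10 := ha' 1 0 (by decide)
    have a20 := ha' 2 0 (by decide)
    have a21 := ha' 2 1 (by decide)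
    have b10 := hb' 1 0 (by decide)
    have b20 := hb' 2 0 (by decide)
    have b21 := hb' 2 1 (by decide)
    constructor
    · intro i
      fin_cases i <;> simp [Matrix.mul_apply, Fin.sum_univ_three, ha, hb, a10, a20, a21,
        b10, b20, b21]
    · intro i j hij
      fin_cases i <;> fin_cases j <;> first
        | exact absurd hij (by decide)
        | simp [Matrix.mul_apply, Fin.sum_univ_three, a10, a20, a21, b10, b20, b21]
  inv_mem' := by
    rintro a ⟨ha, ha'⟩
    have a10 := ha' 1 0 (by decide)
    have a20 := ha' 2 0 (by decide)
    have a21 := ha' 2 1 (by decide)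
    constructor
    · intro i
      fin_cases i <;> simp [Matrix.adjugate_fin_three, ha,
        a10, a20, a21]
    · intro i j hij
      fin_cases i <;> fin_cases j <;> first
        | exact absurd hij (by decide)
        | simp [Matrix.adjugate_fin_three, a10, a20, a21]

/-- `Γ_∞ = U(ℤ)`. -/
abbrev GammaInf : Subgroup (SpecialLinearGroup (Fin 3) ℤ) := unipotent ℤ

/-- The long Weyl element `w₀ = s_α s_β s_α`, as a matrix. -/
def w0 : Matrix (Fin 3) (Fin 3) ℝ := !![0, 0, 1; 0, -1, 0; 1, 0, 0]

/-- The diagonal matrix `t(c₁, c₂) = diag(c₁, c₂ / c₁, 1 / c₂)`. -/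
noncomputable def torus (c₁ c₂ : ℤ) : Matrix (Fin 3) (Fin 3) ℝ :=
  Matrix.diagonal ![(c₁ : ℝ), c₂ / c₁, 1 / c₂]

/-- `A = u_L w₀ t(c₁, c₂) u_R`, with real unipotent `u_L`, `u_R`. -/
def IsBruhat (c₁ c₂ : ℤ) (A : SpecialLinearGroup (Fin 3) ℤ) (uL uR : unipotent ℝ) : Prop :=
  (A : Matrix (Fin 3) (Fin 3) ℤ).map (Int.cast : ℤ → ℝ) =
    (uL : Matrix (Fin 3) (Fin 3) ℝ) * w0 * torus c₁ c₂ * (uR : Matrix (Fin 3) (Fin 3) ℝ)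

/-- `e(x) = exp(2πix)`. -/
noncomputable def expE (x : ℝ) : ℂ := Complex.exp (2 * Real.pi * Complex.I * x)

/-- The character `ψ_m(u) = e(m₁ u₁₂ + m₂ u₂₃)` of the real unipotent group. -/
noncomputable def psi (m : ℤ × ℤ) (u : unipotent ℝ) : ℂ :=
  expE (m.1 * (u : SpecialLinearGroup (Fin 3) ℝ) 0 1 +
    m.2 * (u : SpecialLinearGroup (Fin 3) ℝ) 1 2)

open Classical in
/-- `ψ_m(u_L) ψ_n(u_R)` where `A = u_L w₀ t(c₁, c₂) u_R` (and `0` if there is no such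
decomposition). The decomposition is unique, see `kloostermanTerm_eq`. -/
noncomputable def kloostermanTerm (m n : ℤ × ℤ) (c₁ c₂ : ℤ)
    (A : SpecialLinearGroup (Fin 3) ℤ) : ℂ :=
  if h : ∃ u : unipotent ℝ × unipotent ℝ, IsBruhat c₁ c₂ A u.1 u.2 then
    psi m h.choose.1 * psi n h.choose.2
  else 0

theorem IsBruhat.entries {c₁ c₂ : ℤ} {A : SpecialLinearGroup (Fin 3) ℤ} {uL uR : unipotent ℝ}
    (h : IsBruhat c₁ c₂ A uL uR) :
    (c₁ : ℝ) ≠ 0 ∧ (c₂ : ℝ) ≠ 0 ∧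
    (uL : SpecialLinearGroup (Fin 3) ℝ) 0 1 = (A 0 0 * A 2 1 - A 0 1 * A 2 0 : ℝ) / c₂ ∧
    (uL : SpecialLinearGroup (Fin 3) ℝ) 1 2 = (A 1 0 : ℝ) / c₁ ∧
    (uR : SpecialLinearGroup (Fin 3) ℝ) 0 1 = (A 2 1 : ℝ) / c₁ ∧
    (uR : SpecialLinearGroup (Fin 3) ℝ) 1 2 = (A 1 0 * A 2 2 - A 1 2 * A 2 0 : ℝ) / c₂ := by
  obtain ⟨uL, hL, hL'⟩ := uL
  obtain ⟨uR, hR, hR'⟩ := uR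
  have hd := congrArg Matrix.det h
  have hA : ((A : Matrix (Fin 3) (Fin 3) ℤ).map (Int.cast : ℤ → ℝ)).det = 1 := by
    have := (SpecialLinearGroup.map (Int.castRingHom ℝ) A).det_coe
    simpa using this
  rw [hA] at hd
  simp only [Matrix.det_mul, torus, Matrix.det_diagonal,
    Fin.prod_univ_three] at hd
  have h1 : (c₁ : ℝ) ≠ 0 := by
    intro h0
    simp [h0] at hd
  have h2 : (c₂ : ℝ) ≠ 0 := by
    intro h0
    simp [h0] at hd
  have l10 := hL' 1 0 (by decide)
  have l20 := hL' 2 0 (by decide)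
  have l21 := hL' 2 1 (by decide)
  have r10 := hR' 1 0 (by decide)
  have r20 := hR' 2 0 (by decide)
  have r21 := hR' 2 1 (by decide)
  have E : ∀ i j, ((A i j : ℤ) : ℝ) = _ := fun i j => congrFun (congrFun h i) j
  have e00 := E 0 0
  have e01 := E 0 1
  have e10 := E 1 0
  have e12 := E 1 2
  have e20 := E 2 0
  have e21 := E 2 1
  have e22 := E 2 2
  simp [Matrix.mul_apply, Fin.sum_univ_three, w0, torus, Matrix.diagonal, hL, hR,
    l10, l20, l21, r10, r20, r21] at e00 e01 e10 e12 e20 e21 e22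
  refine ⟨h1, h2, ?_, ?_, ?_, ?_⟩
  · rw [e00, e01, e20, e21]; field_simp; ring
  · rw [e10]; field_simp
  · rw [e21]; field_simp
  · rw [e10, e12, e20, e22]; field_simp; ring

/-- The value of the term may be computed from any decomposition. -/
theorem kloostermanTerm_eq (m n : ℤ × ℤ) {c₁ c₂ : ℤ} {A : SpecialLinearGroup (Fin 3) ℤ}
    {uL uR : unipotent ℝ} (h : IsBruhat c₁ c₂ A uL uR) :
    kloostermanTerm m n c₁ c₂ A = psi m uL * psi n uR := by
  have hex : ∃ u : unipotent ℝ × unipotent ℝ, IsBruhat c₁ c₂ A u.1 u.2 := ⟨(uL, uR), h⟩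
  rw [kloostermanTerm, dif_pos hex]
  obtain ⟨-, -, a1, a2, a3, a4⟩ := hex.choose_spec.entries
  obtain ⟨-, -, b1, b2, b3, b4⟩ := h.entries
  simp only [psi, a1, a2, a3, a4, b1, b2, b3, b4]

/-- The image in `U(ℝ)` of an element of `Γ_∞`. -/
def gammaInfToReal (g : GammaInf) : unipotent ℝ :=
  ⟨SpecialLinearGroup.map (Int.castRingHom ℝ) g.1, by
    obtain ⟨g, h, h'⟩ := g
    exact ⟨fun i => by simp [h], fun i j hij => by simp [h' i j hij]⟩⟩

theorem psi_mul (m : ℤ × ℤ) (u v : unipotent ℝ) : psi m (u * v) = psi m u * psi m v := by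
  obtain ⟨u, hu, hu'⟩ := u
  obtain ⟨v, hv, hv'⟩ := v
  have u10 := hu' 1 0 (by decide)
  have v21 := hv' 2 1 (by decide)
  simp only [psi, expE, ← Complex.exp_add]
  congr 1
  simp [Matrix.mul_apply, Fin.sum_univ_three, hu, hv, u10, v21]
  ring

theorem psi_gammaInfToReal (m : ℤ × ℤ) (g : GammaInf) : psi m (gammaInfToReal g) = 1 := by
  have := Complex.exp_int_mul_two_pi_mul_I (m.1 * g.1 0 1 + m.2 * g.1 1 2)
  rw [psi, expE, ← this]
  congr 1
  simp [gammaInfToReal]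
  ring

theorem IsBruhat.translate {c₁ c₂ : ℤ} {A : SpecialLinearGroup (Fin 3) ℤ} {uL uR : unipotent ℝ}
    (h : IsBruhat c₁ c₂ A uL uR) (g k : GammaInf) :
    IsBruhat c₁ c₂ (g.1 * A * k.1) ((gammaInfToReal g) * uL) (uR * (gammaInfToReal k)) := by
  have key : ∀ X Y : Matrix (Fin 3) (Fin 3) ℤ, (X * Y).map (Int.cast : ℤ → ℝ) =
      X.map (Int.cast : ℤ → ℝ) * Y.map (Int.cast : ℤ → ℝ) :=
    fun X Y => Matrix.map_mul (f := Int.castRingHom ℝ)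
  have hl : IsBruhat c₁ c₂ (g.1 * A * k.1) (gammaInfToReal g * uL) (uR * gammaInfToReal k) ↔
      (g.1.1 * A.1 * k.1.1).map (Int.cast : ℤ → ℝ) =
        (g.1.1.map (Int.cast : ℤ → ℝ) * uL.1.1) * w0 * torus c₁ c₂ *
          (uR.1.1 * k.1.1.map (Int.cast : ℤ → ℝ)) := Iff.rfl
  have h' : A.1.map (Int.cast : ℤ → ℝ) = uL.1.1 * w0 * torus c₁ c₂ * uR.1.1 := h
  rw [hl, key, key, h']
  simp only [Matrix.mul_assoc]

/-- The term depends only on the double coset `Γ_∞ A Γ_∞`. -/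
theorem kloostermanTerm_invariant (m n : ℤ × ℤ) (c₁ c₂ : ℤ)
    (A B : SpecialLinearGroup (Fin 3) ℤ)
    (h : DoubleCoset.setoid (GammaInf : Set (SpecialLinearGroup (Fin 3) ℤ)) GammaInf A B) :
    kloostermanTerm m n c₁ c₂ A = kloostermanTerm m n c₁ c₂ B := by
  have aux : ∀ A B : SpecialLinearGroup (Fin 3) ℤ,
      DoubleCoset.setoid (GammaInf : Set (SpecialLinearGroup (Fin 3) ℤ)) GammaInf A B →
      ∀ uL uR, IsBruhat c₁ c₂ A uL uR →
        kloostermanTerm m n c₁ c₂ A = kloostermanTerm m n c₁ c₂ B := by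
    intro A B h uL uR hA
    obtain ⟨g, hg, k, hk, rfl⟩ := DoubleCoset.rel_iff.1 h
    rw [kloostermanTerm_eq m n hA,
      kloostermanTerm_eq m n (hA.translate ⟨g, hg⟩ ⟨k, hk⟩), psi_mul, psi_mul,
      psi_gammaInfToReal, psi_gammaInfToReal, one_mul, mul_one]
  by_cases hA : ∃ u : unipotent ℝ × unipotent ℝ, IsBruhat c₁ c₂ A u.1 u.2
  · obtain ⟨u, hu⟩ := hA
    exact aux A B h _ _ hu
  by_cases hB : ∃ u : unipotent ℝ × unipotent ℝ, IsBruhat c₁ c₂ B u.1 u.2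
  · obtain ⟨u, hu⟩ := hB
    exact (aux B A ((DoubleCoset.setoid _ _).symm h) _ _ hu).symm
  rw [kloostermanTerm, kloostermanTerm, dif_neg hA, dif_neg hB]

/-- The set `Γ_∞ \ X / Γ_∞` of double cosets of elements of `X`. -/
def doubleCosets (X : Set (SpecialLinearGroup (Fin 3) ℤ)) :
    Set (DoubleCoset.Quotient (GammaInf : Set (SpecialLinearGroup (Fin 3) ℤ)) GammaInf) :=
  DoubleCoset.mk GammaInf GammaInf '' X

/-- `ψ_m(u_L) ψ_n(u_R)` as a function of the double coset of `u_L w₀ t(c₁, c₂) u_R`. -/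
noncomputable def cosetTerm (m n : ℤ × ℤ) (c₁ c₂ : ℤ) :
    DoubleCoset.Quotient (GammaInf : Set (SpecialLinearGroup (Fin 3) ℤ)) GammaInf → ℂ :=
  Quotient.lift (kloostermanTerm m n c₁ c₂) (kloostermanTerm_invariant m n c₁ c₂)

/-- The coarse Kloosterman set `Ω_{w₀}(c₁, c₂)`. -/
def coarseSet (c₁ c₂ : ℤ) : Set (SpecialLinearGroup (Fin 3) ℤ) :=
  {A | ∃ uL uR : unipotent ℝ, IsBruhat c₁ c₂ A uL uR}

/-- The fine Kloosterman set `Ω(d₁, d₂, f)`. -/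
def fineSet (d₁ d₂ : ℤ) (f : ℕ) : Set (SpecialLinearGroup (Fin 3) ℤ) :=
  {A | Int.gcd (A 2 0) (A 2 1) = f ∧ A 2 0 = d₁ * f ∧
    (!![A 1 0, A 1 1; A 2 0, A 2 1] : Matrix (Fin 2) (Fin 2) ℤ).det = d₂ * f}

/-- The coarse long word Kloosterman sum `S_{w₀}(m, n; (c₁, c₂))`. -/
noncomputable def coarseKloosterman (m n : ℤ × ℤ) (c₁ c₂ : ℤ) : ℂ :=
  ∑ᶠ q ∈ doubleCosets (coarseSet c₁ c₂), cosetTerm m n c₁ c₂ q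

/-- The fine long word Kloosterman sum `𝒮_{w₀}(m, n; d₁, d₂, f)`. -/
noncomputable def fineKloosterman (m n : ℤ × ℤ) (d₁ d₂ : ℤ) (f : ℕ) : ℂ :=
  ∑ᶠ q ∈ doubleCosets (fineSet d₁ d₂ f), cosetTerm m n (d₁ * f) (d₂ * f) q

/-- Pairs of residues `(x, y)` modulo `c`, represented in `{0, …, |c| - 1}`, such that
`x y ≡ 1 (mod c)`. -/
def inversePairs (c : ℤ) : Finset (ℕ × ℕ) :=
  {p ∈ Finset.range c.natAbs ×ˢ Finset.range c.natAbs | (p.1 : ℤ) * p.2 ≡ 1 [ZMOD c]}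

/-- The classical Kloosterman sum `S(m, n; c)`. -/
noncomputable def kloosterman (m n c : ℤ) : ℂ :=
  ∑ p ∈ inversePairs c, expE ((m * p.1 : ℝ) / c + (n * p.2 : ℝ) / c)

/-! Following `w₀ = s_α s_β s_α`, every `A` in Ω(d₁, d₂, f) is, modulo Γ_∞ on both sides, a product
ι(g₂) ι'(g₃) ι(g₁) of embedded SL₂(ℤ) matrices with lower left entries d₂, f, d₁. The bottom row of
`A` is f(d₁, y₁), y₃, which gives the lower rows of g₁ and g₃; undoing g₁ leaves the primitive first
column (x₂, d₂, 0) of ι(g₂). Hence the double cosets correspond to inverse pairs modulo d₁, d₂ and f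
together with a residue k modulo f (`cellCoset_bijOn`). The extra k appears because, once y₁ is
fixed, the upper left entry x₁ + d₁k of g₁ matters modulo d₁f.

The Bruhat coordinates are quotients of minors, so on these representatives the phase splits into a
Kloosterman phase modulo d₁, one modulo d₂, and e(k(m₂d₂ + n₂d₁y₃)/f) (`cosetTerm_cellCoset`).
Summing over k yields f times the indicator of m₂d₂ + n₂d₁y₃ ≡ 0 (f). As y₃ is a unit, this
congruence forces the two gcds to agree, whence the vanishing.

For the coarse sum, gcd(A₃₁, A₃₂) is constant on double cosets and partitions the coarse set into
fine ones. -/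

/-! ### Double cosets and Bruhat coordinates on the big cell -/

/-- The unipotent matrix with entries `a`, `b` above the diagonal and `c` in the corner. -/
def upperUni {R : Type*} [CommRing R] (a b c : R) : unipotent R :=
  ⟨⟨!![1, a, c; 0, 1, b; 0, 0, 1], by simp [Matrix.det_fin_three]⟩, by
    constructor
    · intro i
      fin_cases i <;> simp
    · intro i j hij
      fin_cases i <;> fin_cases j <;> first
        | exact absurd hij (by decide)
        | simp⟩

theorem exists_eq_upperUni {R : Type*} [CommRing R] (u : unipotent R) :
    ∃ a b c, u = upperUni a b c := by
  obtain ⟨u, h, h'⟩ := u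
  refine ⟨u 0 1, u 1 2, u 0 2, ?_⟩
  ext i j
  have h0 := h 0
  have h1 := h 1
  have h2 := h 2
  have u10 := h' 1 0 (by decide)
  have u20 := h' 2 0 (by decide)
  have u21 := h' 2 1 (by decide)
  fin_cases i <;> fin_cases j <;> simp [upperUni, h0, h1, h2, u10, u20, u21]

theorem mk_eq_mk_iff (A B : SpecialLinearGroup (Fin 3) ℤ) :
    DoubleCoset.mk GammaInf GammaInf A = DoubleCoset.mk GammaInf GammaInf B ↔
      ∃ a b c x y z : ℤ, B = (upperUni a b c).1 * A * (upperUni x y z).1 := by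
  rw [DoubleCoset.eq]
  constructor
  · rintro ⟨u, hu, v, hv, rfl⟩
    obtain ⟨a, b, c, h⟩ := exists_eq_upperUni ⟨u, hu⟩
    obtain ⟨x, y, z, h'⟩ := exists_eq_upperUni ⟨v, hv⟩
    exact ⟨a, b, c, x, y, z, by rw [← h, ← h']⟩
  · rintro ⟨a, b, c, x, y, z, rfl⟩
    exact ⟨_, (upperUni a b c).2, _, (upperUni x y z).2, rfl⟩

theorem upperUni_mul_mul_apply (A : SpecialLinearGroup (Fin 3) ℤ) (a b c x y z : ℤ) :
    ((upperUni a b c).1 * A * (upperUni x y z).1 : SpecialLinearGroup (Fin 3) ℤ).1 =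
      !![A 0 0 + a * A 1 0 + c * A 2 0,
        (A 0 0 + a * A 1 0 + c * A 2 0) * x + (A 0 1 + a * A 1 1 + c * A 2 1),
        (A 0 0 + a * A 1 0 + c * A 2 0) * z + (A 0 1 + a * A 1 1 + c * A 2 1) * y
          + (A 0 2 + a * A 1 2 + c * A 2 2);
        A 1 0 + b * A 2 0, (A 1 0 + b * A 2 0) * x + (A 1 1 + b * A 2 1),
        (A 1 0 + b * A 2 0) * z + (A 1 1 + b * A 2 1) * y + (A 1 2 + b * A 2 2);
        A 2 0, A 2 0 * x + A 2 1, A 2 0 * z + A 2 1 * y + A 2 2] := by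
  change (upperUni a b c).1.1 * A.1 * (upperUni x y z).1.1 = _
  ext i j
  fin_cases i <;> fin_cases j <;>
    simp [upperUni, Matrix.mul_apply, Fin.sum_univ_three, Matrix.vecMul, dotProduct]

theorem w0_mul_torus (c₁ c₂ : ℤ) :
    w0 * torus c₁ c₂ = !![0, 0, 1 / (c₂ : ℝ); 0, -(c₂ / c₁ : ℝ), 0; (c₁ : ℝ), 0, 0] := by
  ext i j
  rw [torus, Matrix.mul_diagonal]
  fin_cases i <;> fin_cases j <;> simp [w0]

theorem det_entries (A : SpecialLinearGroup (Fin 3) ℤ) :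
    A 0 0 * A 1 1 * A 2 2 - A 0 0 * A 1 2 * A 2 1 - A 0 1 * A 1 0 * A 2 2
      + A 0 1 * A 1 2 * A 2 0 + A 0 2 * A 1 0 * A 2 1 - A 0 2 * A 1 1 * A 2 0 = 1 := by
  rw [← Matrix.det_fin_three]
  exact A.2

theorem exists_isBruhat {c₁ c₂ : ℤ} (h₁ : c₁ ≠ 0) (h₂ : c₂ ≠ 0)
    {A : SpecialLinearGroup (Fin 3) ℤ} (hA₁ : A 2 0 = c₁)
    (hA₂ : A 1 0 * A 2 1 - A 1 1 * A 2 0 = c₂) :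
    IsBruhat c₁ c₂ A
      (upperUni ((A 0 0 * A 2 1 - A 0 1 * A 2 0 : ℝ) / c₂) ((A 1 0 : ℝ) / c₁) ((A 0 0 : ℝ) / c₁))
      (upperUni ((A 2 1 : ℝ) / c₁) ((A 1 0 * A 2 2 - A 1 2 * A 2 0 : ℝ) / c₂)
        ((A 2 2 : ℝ) / c₁)) := by
  have hd : ((A 0 0 * A 1 1 * A 2 2 - A 0 0 * A 1 2 * A 2 1 - A 0 1 * A 1 0 * A 2 2
      + A 0 1 * A 1 2 * A 2 0 + A 0 2 * A 1 0 * A 2 1 - A 0 2 * A 1 1 * A 2 0 : ℤ) : ℝ) = 1 := by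
    rw [det_entries]; norm_num
  have r₁ : (c₁ : ℝ) ≠ 0 := by exact_mod_cast h₁
  have r₂ : (c₂ : ℝ) ≠ 0 := by exact_mod_cast h₂
  have e₁ : (A 2 0 : ℝ) = c₁ := by exact_mod_cast hA₁
  have e₂ : (A 1 0 * A 2 1 - A 1 1 * A 2 0 : ℝ) = c₂ := by exact_mod_cast hA₂
  push_cast at hd
  rw [e₁] at e₂ hd
  rw [IsBruhat, Matrix.mul_assoc _ w0, w0_mul_torus]
  ext i j
  fin_cases i <;> fin_cases j <;>
    simp [upperUni, Matrix.mul_apply, Fin.sum_univ_three, e₁] <;>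
    field_simp
  · ring
  -- The upper right entry has cofactor c₂, so `det A = 1` determines it from the others.
  · have h : (A 0 2 : ℝ) * c₂ = A 0 2 * (A 1 0 * A 2 1 - A 1 1 * c₁) := by rw [e₂]
    linear_combination c₁ * h + c₁ * hd + (A 0 0 * A 2 2 : ℝ) * e₂
  · linear_combination -e₂
  · ring

theorem mem_coarseSet_iff {c₁ c₂ : ℤ} (h₁ : c₁ ≠ 0) (h₂ : c₂ ≠ 0)
    (A : SpecialLinearGroup (Fin 3) ℤ) :
    A ∈ coarseSet c₁ c₂ ↔ A 2 0 = c₁ ∧ A 1 0 * A 2 1 - A 1 1 * A 2 0 = c₂ := by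
  refine ⟨?_, fun h => ⟨_, _, exists_isBruhat h₁ h₂ h.1 h.2⟩⟩
  rintro ⟨uL, uR, h⟩
  obtain ⟨a, b, c, rfl⟩ := exists_eq_upperUni uL
  obtain ⟨x, y, z, rfl⟩ := exists_eq_upperUni uR
  have r₁ : (c₁ : ℝ) ≠ 0 := by exact_mod_cast h₁
  rw [IsBruhat, Matrix.mul_assoc _ w0, w0_mul_torus] at h
  have E : ∀ i j, ((A i j : ℤ) : ℝ) = _ := fun i j => congrFun (congrFun h i) j
  have e10 := E 1 0
  have e11 := E 1 1
  have e20 := E 2 0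
  have e21 := E 2 1
  simp [Matrix.mul_apply, Fin.sum_univ_three, upperUni]
    at e10 e11 e20 e21
  refine ⟨e20, ?_⟩
  have : (A 1 0 * A 2 1 - A 1 1 * A 2 0 : ℝ) = c₂ := by
    rw [e10, e11, e20, e21]
    field_simp
    ring
  exact_mod_cast this

theorem kloostermanTerm_eq_expE (m n : ℤ × ℤ) {c₁ c₂ : ℤ} (h₁ : c₁ ≠ 0) (h₂ : c₂ ≠ 0)
    {A : SpecialLinearGroup (Fin 3) ℤ} (hA₁ : A 2 0 = c₁)
    (hA₂ : A 1 0 * A 2 1 - A 1 1 * A 2 0 = c₂) :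
    kloostermanTerm m n c₁ c₂ A =
      expE (m.1 * ((A 0 0 * A 2 1 - A 0 1 * A 2 0 : ℝ) / c₂) + m.2 * ((A 1 0 : ℝ) / c₁) +
        (n.1 * ((A 2 1 : ℝ) / c₁) + n.2 * ((A 1 0 * A 2 2 - A 1 2 * A 2 0 : ℝ) / c₂))) := by
  rw [kloostermanTerm_eq m n (exists_isBruhat h₁ h₂ hA₁ hA₂)]
  simp only [psi, expE, ← Complex.exp_add]
  congr 1
  simp [upperUni]
  ring

theorem mem_fineSet_iff {d₁ d₂ : ℤ} {f : ℕ} {A : SpecialLinearGroup (Fin 3) ℤ} :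
    A ∈ fineSet d₁ d₂ f ↔ Int.gcd (A 2 0) (A 2 1) = f ∧ A 2 0 = d₁ * f ∧
      A 1 0 * A 2 1 - A 1 1 * A 2 0 = d₂ * f := by
  simp [fineSet, Matrix.det_fin_two]

/-! ### Residues and their inverses -/

theorem mem_inversePairs {c : ℤ} {p : ℕ × ℕ} :
    p ∈ inversePairs c ↔
      p.1 < c.natAbs ∧ p.2 < c.natAbs ∧ (p.1 : ℤ) * p.2 ≡ 1 [ZMOD c] := by
  simp [inversePairs, and_assoc]

theorem swap_mem_inversePairs {c : ℤ} {p : ℕ × ℕ} (hp : p ∈ inversePairs c) :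
    p.swap ∈ inversePairs c := by
  rw [mem_inversePairs] at *
  exact ⟨hp.2.1, hp.1, by simpa [mul_comm] using hp.2.2⟩

theorem eq_of_dvd_sub_of_lt {c : ℤ} {a b : ℕ} (ha : a < c.natAbs) (hb : b < c.natAbs)
    (h : c ∣ (a : ℤ) - b) : a = b := by
  have h' : ((c.natAbs : ℕ) : ℤ) ∣ (b : ℤ) - a := by
    rw [Int.natAbs_dvd, ← neg_sub, dvd_neg]; exact h
  exact Nat.ModEq.eq_of_lt_of_lt (Nat.modEq_iff_dvd.2 h') ha hb

theorem inversePairs_snd_unique {c : ℤ} {a b b' : ℕ} (h : (a, b) ∈ inversePairs c)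
    (h' : (a, b') ∈ inversePairs c) : b = b' := by
  rw [mem_inversePairs] at h h'
  refine eq_of_dvd_sub_of_lt h.2.1 h'.2.1 ?_
  obtain ⟨s, hs⟩ := h.2.2.dvd
  obtain ⟨t, ht⟩ := h'.2.2.dvd
  simp only at hs ht
  exact ⟨b * t - b' * s, by linear_combination (b : ℤ) * ht - (b' : ℤ) * hs⟩

theorem inversePairs_fst_unique {c : ℤ} {a a' b : ℕ} (h : (a, b) ∈ inversePairs c)
    (h' : (a', b) ∈ inversePairs c) : a = a' :=
  inversePairs_snd_unique (swap_mem_inversePairs h) (swap_mem_inversePairs h')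

theorem exists_mem_inversePairs {c a : ℤ} (hc : c ≠ 0) (h : IsCoprime a c) :
    ∃ p ∈ inversePairs c, ∃ x : ℤ, (p.1 : ℤ) = a + c * x := by
  have key : ∀ t : ℤ, ∃ n : ℕ, n < c.natAbs ∧ ∃ x : ℤ, (n : ℤ) = t + c * x := fun t => by
    refine ⟨(t % c).toNat, ?_, -(t / c), ?_⟩
    · have := Int.emod_lt_abs t hc
      rw [Int.abs_eq_natAbs] at this
      have := Int.emod_nonneg t hc
      omega
    · rw [Int.toNat_of_nonneg (Int.emod_nonneg t hc)]
      linear_combination Int.mul_ediv_add_emod t c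
  obtain ⟨s, t, hst⟩ := h
  obtain ⟨n, hn, x, hx⟩ := key a
  obtain ⟨k, hk, y, hy⟩ := key s
  refine ⟨(n, k), mem_inversePairs.2 ⟨hn, hk, ?_⟩, x, hx⟩
  refine (Int.modEq_iff_dvd.2 ⟨t - x * s - a * y - c * x * y, ?_⟩)
  simp only [hx, hy]
  linear_combination -hst

/-! ### Parametrization of the fine double cosets -/

/-- The product `ι(g₂) ι'(g₃) ι(g₁)`, where `gᵢ = !![aᵢ, bᵢ; dᵢ, eᵢ]` and `ι`, `ι'` are the upper
left and the lower right embeddings of `2 × 2` matrices. -/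
def cellMatrix (a₁ b₁ d₁ e₁ a₂ b₂ d₂ e₂ a₃ b₃ d₃ e₃ : ℤ) : Matrix (Fin 3) (Fin 3) ℤ :=
  !![a₂ * a₁ + b₂ * a₃ * d₁, a₂ * b₁ + b₂ * a₃ * e₁, b₂ * b₃;
    d₂ * a₁ + e₂ * a₃ * d₁, d₂ * b₁ + e₂ * a₃ * e₁, e₂ * b₃;
    d₃ * d₁, d₃ * e₁, e₃]

theorem det_cellMatrix (a₁ b₁ d₁ e₁ a₂ b₂ d₂ e₂ a₃ b₃ d₃ e₃ : ℤ) :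
    (cellMatrix a₁ b₁ d₁ e₁ a₂ b₂ d₂ e₂ a₃ b₃ d₃ e₃).det =
      (a₁ * e₁ - b₁ * d₁) * (a₂ * e₂ - b₂ * d₂) * (a₃ * e₃ - b₃ * d₃) := by
  simp [cellMatrix, Matrix.det_fin_three]
  ring

/-- The parameters of the double cosets in `Γ_∞ \ Ω(d₁, d₂, f) / Γ_∞`. -/
def cellIndex (d₁ d₂ : ℤ) (f : ℕ) : Finset ((ℕ × ℕ) × (ℕ × ℕ) × (ℕ × ℕ) × ℕ) :=
  inversePairs f ×ˢ inversePairs d₂ ×ˢ inversePairs d₁ ×ˢ Finset.range f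

/-- The double coset with a given parameter. -/
def cellCoset (d₁ d₂ : ℤ) (f : ℕ) (t : (ℕ × ℕ) × (ℕ × ℕ) × (ℕ × ℕ) × ℕ) :
    DoubleCoset.Quotient (GammaInf : Set (SpecialLinearGroup (Fin 3) ℤ)) GammaInf :=
  -- The index is t = ((x₃, y₃), (x₂, y₂), (y₁, x₁), k); in the third pair y₁ comes first.
  let a₁ : ℤ := t.2.2.1.2 + d₁ * t.2.2.2
  let M := cellMatrix a₁ ((a₁ * t.2.2.1.1 - 1) / d₁) d₁ t.2.2.1.1
    t.2.1.1 ((t.2.1.1 * t.2.1.2 - 1) / d₂) d₂ t.2.1.2 t.1.1 ((t.1.1 * t.1.2 - 1) / f) f t.1.2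
  if h : M.det = 1 then DoubleCoset.mk GammaInf GammaInf ⟨M, h⟩ else DoubleCoset.mk _ _ 1

/-- Replaces the quotients in `cellCoset` by Bézout cofactors bᵢ, so that later verifications are
polynomial identities modulo det gᵢ = 1. -/
theorem cellCoset_eq_mk {d₁ d₂ : ℤ} {f : ℕ} {x₁ y₁ x₂ y₂ x₃ y₃ k : ℕ}
    (ht : ((x₃, y₃), (x₂, y₂), (y₁, x₁), k) ∈ cellIndex d₁ d₂ f) :
    ∃ b₁ b₂ b₃ : ℤ, ∃ A : SpecialLinearGroup (Fin 3) ℤ,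
      (x₁ + d₁ * k) * y₁ - b₁ * d₁ = 1 ∧ (x₂ : ℤ) * y₂ - b₂ * d₂ = 1 ∧
      (x₃ : ℤ) * y₃ - b₃ * f = 1 ∧
      cellCoset d₁ d₂ f ((x₃, y₃), (x₂, y₂), (y₁, x₁), k) = DoubleCoset.mk GammaInf GammaInf A ∧
      A.1 = cellMatrix (x₁ + d₁ * k) b₁ d₁ y₁ x₂ b₂ d₂ y₂ x₃ b₃ f y₃ := by
  simp only [cellIndex, Finset.mem_product] at ht
  obtain ⟨h₃, h₂, h₁, -⟩ := ht
  replace h₁ := (mem_inversePairs.1 h₁).2.2.symm.dvd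
  replace h₂ := (mem_inversePairs.1 h₂).2.2.symm.dvd
  replace h₃ := (mem_inversePairs.1 h₃).2.2.symm.dvd
  have h₁' : d₁ ∣ (x₁ + d₁ * k) * y₁ - 1 := by
    obtain ⟨s, hs⟩ := h₁
    exact ⟨s + k * y₁, by linear_combination hs⟩
  have e₁ := Int.ediv_mul_cancel h₁'
  have e₂ := Int.ediv_mul_cancel h₂
  have e₃ := Int.ediv_mul_cancel h₃
  have q₁ : (x₁ + d₁ * k) * y₁ - ((x₁ + d₁ * k) * y₁ - 1) / d₁ * d₁ = 1 := by
    rw [e₁]; ring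
  have q₂ : (x₂ : ℤ) * y₂ - ((x₂ : ℤ) * y₂ - 1) / d₂ * d₂ = 1 := by
    simp only at e₂
    rw [e₂]; ring
  have q₃ : (x₃ : ℤ) * y₃ - ((x₃ : ℤ) * y₃ - 1) / f * f = 1 := by
    simp only at e₃
    rw [e₃]; ring
  refine ⟨_, _, _, ⟨cellMatrix (x₁ + d₁ * k) _ d₁ y₁ x₂ _ d₂ y₂ x₃ _ f y₃, ?_⟩, q₁, q₂, q₃, ?_, rfl⟩
  · rw [det_cellMatrix, q₁, q₂, q₃]; norm_num
  · rw [cellCoset]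
    exact dif_pos _

theorem cellCoset_mem {d₁ d₂ : ℤ} {f : ℕ} {t : (ℕ × ℕ) × (ℕ × ℕ) × (ℕ × ℕ) × ℕ}
    (ht : t ∈ cellIndex d₁ d₂ f) : cellCoset d₁ d₂ f t ∈ doubleCosets (fineSet d₁ d₂ f) := by
  obtain ⟨⟨x₃, y₃⟩, ⟨x₂, y₂⟩, ⟨y₁, x₁⟩, k⟩ := t
  obtain ⟨b₁, b₂, b₃, A, q₁, q₂, q₃, hA, hM⟩ := cellCoset_eq_mk ht
  rw [hA]
  refine ⟨A, mem_fineSet_iff.2 ?_, rfl⟩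
  rw [hM]
  simp only [cellMatrix, of_apply, cons_val', cons_val, cons_val_fin_one]
  refine ⟨?_, mul_comm _ _, ?_⟩
  · rw [Int.gcd_mul_left]
    have : IsCoprime d₁ (y₁ : ℤ) := ⟨-b₁, x₁ + d₁ * k, by linear_combination q₁⟩
    rw [Int.isCoprime_iff_gcd_eq_one.1 this]
    simp
  · linear_combination (d₂ * f : ℤ) * q₁

/-- The parameters are recovered one at a time: y₁ modulo d₁ and y₃ modulo f from the bottom row, x₂
modulo d₂ from a minor of the first and last rows. Reducedness forces equality, and it kills the
unipotent entries `x` and `a`. -/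
theorem cellCoset_injOn {d₁ d₂ : ℤ} {f : ℕ} (h₁ : d₁ ≠ 0) (h₂ : d₂ ≠ 0) (hf : 0 < f) :
    Set.InjOn (cellCoset d₁ d₂ f) (cellIndex d₁ d₂ f) := by
  rintro ⟨⟨x₃, y₃⟩, ⟨x₂, y₂⟩, ⟨y₁, x₁⟩, k⟩ ht ⟨⟨x₃', y₃'⟩, ⟨x₂', y₂'⟩, ⟨y₁', x₁'⟩, k'⟩ ht' heq
  obtain ⟨b₁, b₂, b₃, A, q₁, q₂, q₃, hA, hM⟩ := cellCoset_eq_mk ht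
  obtain ⟨b₁', b₂', b₃', A', q₁', q₂', q₃', hA', hM'⟩ := cellCoset_eq_mk ht'
  rw [hA, hA', mk_eq_mk_iff] at heq
  obtain ⟨a, b, c, x, y, z, hE⟩ := heq
  have hE := (congrArg Subtype.val hE).trans (upperUni_mul_mul_apply A a b c x y z)
  rw [hM, hM'] at hE
  have E := fun i j => congrFun (congrFun hE i) j
  have E00 := E 0 0
  have E01 := E 0 1
  have E10 := E 1 0
  have E21 := E 2 1
  have E22 := E 2 2
  simp only [cellMatrix, of_apply, cons_val', cons_val, cons_val_fin_one] at E00 E01 E10 E21 E22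
  have hf' : (f : ℤ) ≠ 0 := by exact_mod_cast hf.ne'
  simp only [cellIndex, Finset.coe_product, Set.mem_prod, Finset.mem_coe, Finset.mem_range]
    at ht ht'
  obtain ⟨m₃, m₂, m₁, mk⟩ := ht
  obtain ⟨m₃', m₂', m₁', mk'⟩ := ht'
  obtain rfl : y₁ = y₁' := by
    refine eq_of_dvd_sub_of_lt (mem_inversePairs.1 m₁).1 (mem_inversePairs.1 m₁').1 ⟨-x, ?_⟩
    exact mul_left_cancel₀ hf' (by linear_combination -E21)
  obtain rfl := inversePairs_snd_unique m₁ m₁'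
  obtain rfl : x = 0 :=
    mul_left_cancel₀ (mul_ne_zero hf' h₁) (by linear_combination -E21)
  have hx₂ : (x₂' : ℤ) = x₂ + a * d₂ := by
    linear_combination (y₁ : ℤ) * E00 - d₁ * E01 - (x₂' : ℤ) * q₁' + (x₂ + a * d₂) * q₁
  obtain rfl : x₂ = x₂' :=
    eq_of_dvd_sub_of_lt (mem_inversePairs.1 m₂).1 (mem_inversePairs.1 m₂').1
      ⟨-a, by linear_combination -hx₂⟩
  obtain rfl := inversePairs_snd_unique m₂ m₂'
  obtain rfl : a = 0 := mul_right_cancel₀ h₂ (by linear_combination -hx₂)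
  obtain rfl : b₂ = b₂' := mul_right_cancel₀ h₂ (by linear_combination q₂' - q₂)
  obtain rfl : y₃ = y₃' :=
    eq_of_dvd_sub_of_lt (mem_inversePairs.1 m₃).2.1 (mem_inversePairs.1 m₃').2.1
      ⟨-(d₁ * z + y₁ * y), by linear_combination -E22⟩
  obtain rfl := inversePairs_fst_unique m₃ m₃'
  -- Pairing the first column with (y₂, -b₂), the first row of g₂⁻¹, isolates x₁ + d₁k up to
  -- multiples of d₁f.
  obtain rfl : k = k' := by
    refine eq_of_dvd_sub_of_lt (c := f) (by simpa using mk) (by simpa using mk')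
      ⟨-(y₂ * c - b₂ * b), ?_⟩
    refine mul_left_cancel₀ h₁ ?_
    linear_combination (d₁ * (k' - k)) * q₂ - (y₂ : ℤ) * E00 + b₂ * E10
  rfl

theorem exists_reduced_representative {d₁ d₂ : ℤ} {f : ℕ} (h₁ : d₁ ≠ 0) (h₂ : d₂ ≠ 0) (hf : 0 < f)
    {A : SpecialLinearGroup (Fin 3) ℤ} (hA : A ∈ fineSet d₁ d₂ f) :
    ∃ B : SpecialLinearGroup (Fin 3) ℤ,
      DoubleCoset.mk GammaInf GammaInf A = DoubleCoset.mk GammaInf GammaInf B ∧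
      ∃ x₁ y₁ x₂ y₂ x₃ y₃ : ℕ, (x₃, y₃) ∈ inversePairs f ∧ (x₂, y₂) ∈ inversePairs d₂ ∧
        (y₁, x₁) ∈ inversePairs d₁ ∧ B 2 0 = f * d₁ ∧ B 2 1 = f * y₁ ∧ B 2 2 = y₃ ∧
        B 0 0 * y₁ - B 0 1 * d₁ = x₂ ∧ B 1 0 * y₁ - B 1 1 * d₁ = d₂ := by
  obtain ⟨hg, h20, hm⟩ := mem_fineSet_iff.1 hA
  have hf' : (f : ℤ) ≠ 0 := by exact_mod_cast hf.ne'
  have hdet := det_entries A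
  obtain ⟨e, h21⟩ : (f : ℤ) ∣ A 2 1 := hg ▸ Int.gcd_dvd_right _ _
  have hcop : IsCoprime e d₁ := by
    rw [h20, h21, mul_comm d₁, Int.gcd_mul_left, Int.natAbs_natCast] at hg
    rw [isCoprime_comm, Int.isCoprime_iff_gcd_eq_one]
    exact Nat.eq_of_mul_eq_mul_left hf (by omega)
  rw [h20, h21] at hm hdet
  have hm' : A 1 0 * e - A 1 1 * d₁ = d₂ := mul_left_cancel₀ hf' (by linear_combination hm)
  obtain ⟨s, r, hsr⟩ := hcop
  -- If ι(g₁) has lower row (d₁, e), then A ι(g₁)⁻¹ has first column (this minor, d₂, 0), which is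
  -- primitive.
  have hcop₂ : IsCoprime (A 0 0 * e - A 0 1 * d₁) d₂ := by
    refine ⟨A 2 2 * (s * A 1 1 + r * A 1 0) - f * A 1 2,
      -A 2 2 * (s * A 0 1 + r * A 0 0) + f * A 0 2, ?_⟩
    rw [← hm']
    linear_combination hdet +
      A 2 2 * (A 0 0 * A 1 1 - A 0 1 * A 1 0) * hsr
  have hcop₃ : IsCoprime (A 2 2) (f : ℤ) :=
    ⟨A 0 0 * A 1 1 - A 0 1 * A 1 0, (A 1 0 * A 0 2 - A 0 0 * A 1 2) * e +
      (A 0 1 * A 1 2 - A 0 2 * A 1 1) * d₁, by linear_combination hdet⟩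
  obtain ⟨⟨y₁, x₁⟩, m₁, x, hx⟩ := exists_mem_inversePairs h₁ ⟨s, r, hsr⟩
  obtain ⟨⟨x₂, y₂⟩, m₂, w, hw⟩ := exists_mem_inversePairs h₂ hcop₂
  obtain ⟨⟨y₃, x₃⟩, m₃, v, hv⟩ := exists_mem_inversePairs hf' hcop₃
  simp only at hx hw hv
  -- Since s e + r d₁ = 1, the right factor shifts A₃₃ by exactly f v, while x shifts e by d₁x; the
  -- left factor shifts the minor by w d₂.
  refine ⟨(upperUni w 0 0).1 * A * (upperUni x (s * v) (r * v)).1,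
    (mk_eq_mk_iff _ _).2 ⟨_, _, _, _, _, _, rfl⟩,
    x₁, y₁, x₂, y₂, x₃, y₃, swap_mem_inversePairs m₃, m₂, m₁, ?_⟩
  rw [upperUni_mul_mul_apply]
  simp only [of_apply, cons_val', cons_val, cons_val_fin_one]
  rw [h20, h21, hx, hw, hv]
  refine ⟨by ring, by ring, ?_, ?_, ?_⟩
  · linear_combination f * v * hsr
  · linear_combination w * hm'
  · linear_combination hm'

theorem cellCoset_surjOn {d₁ d₂ : ℤ} {f : ℕ} (h₁ : d₁ ≠ 0) (h₂ : d₂ ≠ 0) (hf : 0 < f) :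
    Set.SurjOn (cellCoset d₁ d₂ f) (cellIndex d₁ d₂ f) (doubleCosets (fineSet d₁ d₂ f)) := by
  rintro _ ⟨A₀, hA₀, rfl⟩
  obtain ⟨B, hB, x₁, y₁, x₂, y₂, x₃, y₃, m₃, m₂, m₁, h20, h21, h22, hm₀, hm₁⟩ :=
    exists_reduced_representative h₁ h₂ hf hA₀
  have hf' : (f : ℤ) ≠ 0 := by exact_mod_cast hf.ne'
  have hdet := det_entries B
  rw [h20, h21, h22] at hdet
  obtain ⟨b₂, hb₂⟩ := (mem_inversePairs.1 m₂).2.2.symm.dvd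
  obtain ⟨b₃, hb₃⟩ := (mem_inversePairs.1 m₃).2.2.symm.dvd
  obtain ⟨s, hs⟩ := (mem_inversePairs.1 m₁).2.2.symm.dvd
  simp only at hb₂ hb₃ hs
  have hp : B 0 2 * d₂ * f - B 1 2 * f * x₂ + y₃ * (B 0 0 * B 1 1 - B 0 1 * B 1 0) = 1 := by
    rw [← hm₀, ← hm₁]
    linear_combination hdet
  -- the first column of `B` in the basis `(x₂, d₂)`, `(b₂, y₂)`
  obtain ⟨α, hα⟩ : ∃ α, α = y₂ * B 0 0 - b₂ * B 1 0 := ⟨_, rfl⟩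
  -- On a cell matrix, α and p are the upper left entries of g₁ and g₃. Here they satisfy α y₁ ≡ 1
  -- (d₁) and p y₃ ≡ 1 (f), so they are x₁ + d₁j and x₃ + fq.
  obtain ⟨p, hp'⟩ : ∃ p, p = B 0 0 * B 1 1 - B 0 1 * B 1 0 := ⟨_, rfl⟩
  rw [← hp'] at hp
  have hdp : d₁ * p = x₂ * B 1 0 - d₂ * B 0 0 := by
    rw [hp', ← hm₀, ← hm₁]; ring
  have h00 : B 0 0 = x₂ * α + b₂ * (d₁ * p) := by
    rw [hα, hdp]; linear_combination -B 0 0 * hb₂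
  have h10 : B 1 0 = d₂ * α + y₂ * (d₁ * p) := by
    rw [hα, hdp]; linear_combination -B 1 0 * hb₂
  obtain ⟨j, hj⟩ : d₁ ∣ α - x₁ := by
    refine ⟨x₁ * (y₂ * B 0 1 - b₂ * B 1 1) - α * s, ?_⟩
    have : α * y₁ = 1 + d₁ * (y₂ * B 0 1 - b₂ * B 1 1) := by
      rw [hα]
      linear_combination (y₂ : ℤ) * hm₀ - b₂ * hm₁ + hb₂
    linear_combination (x₁ : ℤ) * this - α * hs
  obtain ⟨q, hq⟩ : (f : ℤ) ∣ p - x₃ := by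
    refine ⟨-x₃ * (B 0 2 * d₂ - B 1 2 * x₂) - p * b₃, ?_⟩
    linear_combination (x₃ : ℤ) * hp - p * hb₃
  obtain ⟨k, hk, l, hl⟩ : ∃ k < f, ∃ l : ℤ, j = (k : ℕ) + f * l := by
    have hpos : (0 : ℤ) < f := by exact_mod_cast hf
    have := Int.emod_nonneg j hf'
    have := Int.emod_lt_of_pos j hpos
    refine ⟨(j % f).toNat, by omega, j / f, ?_⟩
    rw [Int.toNat_of_nonneg (by assumption)]
    exact (Int.emod_add_mul_ediv j f).symm
  have ht : ((x₃, y₃), (x₂, y₂), (y₁, x₁), k) ∈ cellIndex d₁ d₂ f := by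
    simp only [cellIndex, Finset.mem_product, Finset.mem_range]
    exact ⟨m₃, m₂, m₁, hk⟩
  refine ⟨_, ht, ?_⟩
  obtain ⟨b₁, b₂', b₃', A, q₁, q₂, q₃, hA, hM⟩ := cellCoset_eq_mk ht
  obtain rfl : b₂ = b₂' := mul_right_cancel₀ h₂ (by linear_combination q₂ - hb₂)
  obtain rfl : b₃ = b₃' := mul_right_cancel₀ hf' (by linear_combination q₃ - hb₃)
  rw [hA, hB, mk_eq_mk_iff]
  -- (c, b) = g₂(l, q): adding these multiples of the bottom row to the upper rows absorbs the
  -- excesses l and q.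
  obtain ⟨c, hc⟩ : ∃ c, c = x₂ * l + b₂ * q := ⟨_, rfl⟩
  obtain ⟨b, hb⟩ : ∃ b, b = d₂ * l + y₂ * q := ⟨_, rfl⟩
  have hα' : α = x₁ + d₁ * k + d₁ * f * l := by linear_combination hj + d₁ * hl
  have hp3 : p = x₃ + f * q := by linear_combination hq
  have g00 : B 0 0 = x₂ * (x₁ + d₁ * k) + b₂ * x₃ * d₁ + c * (f * d₁) := by
    rw [h00, hα', hp3, hc]; ring
  have g10 : B 1 0 = d₂ * (x₁ + d₁ * k) + y₂ * x₃ * d₁ + b * (f * d₁) := by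
    rw [h10, hα', hp3, hb]; ring
  have g01 : B 0 1 = x₂ * b₁ + b₂ * x₃ * y₁ + c * (f * y₁) :=
    mul_right_cancel₀ h₁ (by linear_combination (y₁ : ℤ) * g00 - hm₀ + x₂ * q₁)
  have g11 : B 1 1 = d₂ * b₁ + y₂ * x₃ * y₁ + b * (f * y₁) :=
    mul_right_cancel₀ h₁ (by linear_combination (y₁ : ℤ) * g10 - hm₁ + d₂ * q₁)
  obtain ⟨δ₀, hδ₀⟩ : ∃ δ, δ = B 0 2 - b₂ * b₃ - c * y₃ := ⟨_, rfl⟩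
  obtain ⟨δ₁, hδ₁⟩ : ∃ δ, δ = B 1 2 - y₂ * b₃ - b * y₃ := ⟨_, rfl⟩
  -- The remaining discrepancy in the third column is parallel to (x₂, d₂), by comparing
  -- determinants.
  have hδ : δ₀ * d₂ = δ₁ * x₂ := by
    refine mul_right_cancel₀ hf' ?_
    rw [hδ₀, hδ₁, hc, hb]
    rw [hp3] at hp
    linear_combination hp - q₃ + (b₃ * f + q * f * y₃) * q₂
  -- Column one times y₁ minus column two times d₁ is (x₂, d₂, 0), so this right factor removes the
  -- discrepancy without touching the bottom row.
  refine ⟨0, b, c, 0, -d₁ * (y₂ * δ₀ - b₂ * δ₁), y₁ * (y₂ * δ₀ - b₂ * δ₁), ?_⟩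
  refine Subtype.ext (Eq.trans ?_ (upperUni_mul_mul_apply _ _ _ _ _ _ _).symm)
  rw [hM]
  have e02 : B 0 2 = δ₀ + b₂ * b₃ + c * y₃ := by rw [hδ₀]; ring
  have e12 : B 1 2 = δ₁ + y₂ * b₃ + b * y₃ := by rw [hδ₁]; ring
  ext i j
  fin_cases i <;> fin_cases j <;>
    simp only [cellMatrix, of_apply, cons_val', cons_val, cons_val_fin_one, Fin.zero_eta,
      Fin.mk_one, Fin.reduceFinMk, g00, g10, g01, g11, h20, h21, h22, e02, e12]
  · ring
  · ring
  · linear_combination -δ₀ * q₂ - b₂ * hδ - (x₂ * (y₂ * δ₀ - b₂ * δ₁)) * q₁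
  · ring
  · linear_combination -δ₁ * q₂ - y₂ * hδ - (d₂ * (y₂ * δ₀ - b₂ * δ₁)) * q₁
  · ring
  · ring

theorem cellCoset_bijOn {d₁ d₂ : ℤ} {f : ℕ} (h₁ : d₁ ≠ 0) (h₂ : d₂ ≠ 0) (hf : 0 < f) :
    Set.BijOn (cellCoset d₁ d₂ f) (cellIndex d₁ d₂ f) (doubleCosets (fineSet d₁ d₂ f)) :=
  ⟨fun _ => cellCoset_mem, cellCoset_injOn h₁ h₂ hf, cellCoset_surjOn h₁ h₂ hf⟩

/-! ### Evaluation of the fine sum -/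

theorem expE_add (x y : ℝ) : expE (x + y) = expE x * expE y := by
  simp only [expE, ← Complex.exp_add]
  congr 1
  push_cast
  ring

theorem expE_intCast (k : ℤ) : expE k = 1 := by
  rw [expE, ← Complex.exp_int_mul_two_pi_mul_I k]
  congr 1
  push_cast
  ring

theorem expE_natCast_mul (k : ℕ) (x : ℝ) : expE (k * x) = expE x ^ k := by
  rw [expE, expE, ← Complex.exp_nat_mul]
  congr 1
  push_cast
  ring

theorem expE_eq_one_iff (x : ℝ) : expE x = 1 ↔ ∃ k : ℤ, x = k := by
  refine ⟨fun h => ?_, ?_⟩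
  · rw [expE, Complex.exp_eq_one_iff] at h
    obtain ⟨k, hk⟩ := h
    refine ⟨k, ?_⟩
    have : (x : ℂ) = (k : ℂ) := by
      refine mul_left_cancel₀ Complex.two_pi_I_ne_zero ?_
      rw [hk]; ring
    exact_mod_cast this
  · rintro ⟨k, rfl⟩
    exact expE_intCast k

theorem sum_range_expE {f : ℕ} (hf : 0 < f) (a : ℤ) :
    ∑ k ∈ Finset.range f, expE (k * (a / f)) = if a ≡ 0 [ZMOD f] then (f : ℂ) else 0 := by
  have hf' : (f : ℝ) ≠ 0 := by exact_mod_cast hf.ne'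
  simp only [expE_natCast_mul]
  split_ifs with h
  · obtain ⟨k, rfl⟩ := Int.modEq_zero_iff_dvd.1 h
    have : expE (((f * k : ℤ) : ℝ) / f) = 1 :=
      (expE_eq_one_iff _).2 ⟨k, by push_cast; field_simp⟩
    simp only [this, one_pow, Finset.sum_const, Finset.card_range, nsmul_eq_mul, mul_one]
  · rw [geom_sum_eq, ← expE_natCast_mul, mul_div_cancel₀ _ hf', expE_intCast, sub_self, zero_div]
    rw [Ne, expE_eq_one_iff]
    rintro ⟨k, hk⟩
    rw [div_eq_iff hf'] at hk
    exact h (Int.modEq_zero_iff_dvd.2 ⟨k, by rw [mul_comm]; exact_mod_cast hk⟩)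

theorem cosetTerm_cellCoset (m₁ m₂ n₁ n₂ : ℤ) {d₁ d₂ : ℤ} {f : ℕ} (h₁ : d₁ ≠ 0) (h₂ : d₂ ≠ 0)
    (hf : 0 < f) {x₁ y₁ x₂ y₂ x₃ y₃ k : ℕ}
    (ht : ((x₃, y₃), (x₂, y₂), (y₁, x₁), k) ∈ cellIndex d₁ d₂ f) :
    cosetTerm (m₁, m₂) (n₁, n₂) (d₁ * f) (d₂ * f)
        (cellCoset d₁ d₂ f ((x₃, y₃), (x₂, y₂), (y₁, x₁), k)) =
      expE (n₁ * y₁ / d₁ + (m₂ * d₂ + n₂ * d₁ * y₃) / f * x₁ / d₁) *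
        expE (m₁ * x₂ / d₂ + (n₂ * d₁ + m₂ * d₂ * x₃) / f * y₂ / d₂) *
        expE (k * ((m₂ * d₂ + n₂ * d₁ * y₃ : ℤ) / f)) := by
  obtain ⟨b₁, b₂, b₃, A, q₁, q₂, q₃, hA, hM⟩ := cellCoset_eq_mk ht
  have hf' : (f : ℤ) ≠ 0 := by exact_mod_cast hf.ne'
  have r₁ : (d₁ : ℝ) ≠ 0 := by exact_mod_cast h₁
  have r₂ : (d₂ : ℝ) ≠ 0 := by exact_mod_cast h₂
  have r₃ : (f : ℝ) ≠ 0 := by exact_mod_cast hf'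
  rw [hA]
  change kloostermanTerm _ _ _ _ A = _
  rw [kloostermanTerm_eq_expE _ _ (mul_ne_zero h₁ hf') (mul_ne_zero h₂ hf')]
  · rw [hM, ← expE_add, ← expE_add]
    simp only [cellMatrix, of_apply, cons_val', cons_val, cons_val_fin_one]
    congr 1
    have q₁' : ((x₁ + d₁ * k) * y₁ - b₁ * d₁ : ℝ) = 1 := by exact_mod_cast q₁
    have q₃' : (x₃ * y₃ - b₃ * f : ℝ) = 1 := by exact_mod_cast q₃
    push_cast
    field_simp
    -- det g₁ = 1 reduces the minor in u_L to f x₂; det g₃ = 1 eliminates b₃ from the minor in u_R.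
    linear_combination (m₁ * x₂ * d₁ * f : ℝ) * q₁' + (n₂ * y₂ * d₁ ^ 2 : ℝ) * q₃'
  · rw [hM]
    simp only [cellMatrix, of_apply, cons_val', cons_val, cons_val_fin_one]
    ring
  · rw [hM]
    simp only [cellMatrix, of_apply, cons_val', cons_val, cons_val_fin_one]
    linear_combination (d₂ * f : ℤ) * q₁

theorem finite_doubleCosets_fineSet {d₁ d₂ : ℤ} {f : ℕ} (h₁ : d₁ ≠ 0) (h₂ : d₂ ≠ 0)
    (hf : 0 < f) : (doubleCosets (fineSet d₁ d₂ f)).Finite := by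
  rw [← (cellCoset_bijOn h₁ h₂ hf).image_eq]
  exact (Finset.finite_toSet _).image _

theorem fineKloosterman_eq_sum (m₁ m₂ n₁ n₂ : ℤ) {d₁ d₂ : ℤ} {f : ℕ} (h₁ : d₁ ≠ 0) (h₂ : d₂ ≠ 0)
    (hf : 0 < f) :
    fineKloosterman (m₁, m₂) (n₁, n₂) d₁ d₂ f =
      f * ∑ p ∈ inversePairs f with m₂ * d₂ + n₂ * d₁ * p.2 ≡ 0 [ZMOD f],
        kloosterman n₁ ((m₂ * d₂ + n₂ * d₁ * p.2) / f) d₁ *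
          kloosterman m₁ ((n₂ * d₁ + m₂ * d₂ * p.1) / f) d₂ := by
  rw [fineKloosterman, ← finsum_mem_eq_of_bijOn _ (cellCoset_bijOn h₁ h₂ hf) fun _ _ => rfl,
    finsum_mem_coe_finset, cellIndex, Finset.sum_product, Finset.sum_filter, Finset.mul_sum]
  refine Finset.sum_congr rfl ?_
  rintro ⟨x₃, y₃⟩ m₃
  have hf' : (f : ℝ) ≠ 0 := by exact_mod_cast hf.ne'
  trans ∑ p ∈ inversePairs d₂, ∑ q ∈ inversePairs d₁,
    expE (n₁ * q.1 / d₁ + (m₂ * d₂ + n₂ * d₁ * y₃) / f * q.2 / d₁) *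
      expE (m₁ * p.1 / d₂ + (n₂ * d₁ + m₂ * d₂ * x₃) / f * p.2 / d₂) *
      if m₂ * d₂ + n₂ * d₁ * y₃ ≡ 0 [ZMOD f] then (f : ℂ) else 0
  · rw [Finset.sum_product]
    refine Finset.sum_congr rfl fun p hp => ?_
    rw [Finset.sum_product]
    refine Finset.sum_congr rfl fun q hq => ?_
    rw [← sum_range_expE hf, Finset.mul_sum]
    refine Finset.sum_congr rfl fun k hk => ?_
    refine cosetTerm_cellCoset m₁ m₂ n₁ n₂ h₁ h₂ hf ?_
    simp only [cellIndex, Finset.mem_product]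
    exact ⟨m₃, hp, hq, hk⟩
  · split_ifs with h
    · have hM := Int.modEq_zero_iff_dvd.1 h
      -- Modulo f this is x₃(m₂d₂ + n₂d₁y₃), so both integer quotients by f are exact.
      have hN : (f : ℤ) ∣ n₂ * d₁ + m₂ * d₂ * x₃ := by
        obtain ⟨s, hs⟩ := hM
        obtain ⟨b, hb⟩ := (mem_inversePairs.1 m₃).2.2.dvd
        exact ⟨x₃ * s + b * n₂ * d₁, by linear_combination (x₃ : ℤ) * hs + n₂ * d₁ * hb⟩
      rw [kloosterman, kloosterman, Finset.sum_mul_sum, Finset.sum_comm, Finset.mul_sum]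
      refine Finset.sum_congr rfl fun q _ => ?_
      rw [Finset.mul_sum]
      refine Finset.sum_congr rfl fun p _ => ?_
      rw [Int.cast_div hM (by exact_mod_cast hf'), Int.cast_div hN (by exact_mod_cast hf')]
      push_cast
      ring
    · simp

/-- Modulo f, u and v differ by a unit factor, so each is a multiple of the other. -/
theorem gcd_eq_gcd_of_mem_inversePairs {u v : ℤ} {f : ℕ} {p : ℕ × ℕ} (hp : p ∈ inversePairs f)
    (h : u + v * p.2 ≡ 0 [ZMOD f]) : Int.gcd u f = Int.gcd v f := by
  obtain ⟨s, hs⟩ := Int.modEq_zero_iff_dvd.1 h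
  obtain ⟨b, hb⟩ := (mem_inversePairs.1 hp).2.2.dvd
  refine Nat.dvd_antisymm ?_ ?_ <;> refine Int.dvd_gcd ?_ (Int.gcd_dvd_right _ _)
  · have : v = (p.1 * s + v * b) * f - p.1 * u := by
      linear_combination v * hb + (p.1 : ℤ) * hs
    rw [this]
    exact dvd_sub ((Int.gcd_dvd_right _ _).mul_left _) ((Int.gcd_dvd_left _ _).mul_left _)
  · have : u = s * f - p.2 * v := by linear_combination hs
    rw [this]
    exact dvd_sub ((Int.gcd_dvd_right _ _).mul_left _) ((Int.gcd_dvd_left _ _).mul_left _)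

theorem fineKloosterman_eq_zero (m₁ m₂ n₁ n₂ : ℤ) {d₁ d₂ : ℤ} {f : ℕ} (h₁ : d₁ ≠ 0) (h₂ : d₂ ≠ 0)
    (hf : 0 < f) (h : Int.gcd (m₂ * d₂) f ≠ Int.gcd (n₂ * d₁) f) :
    fineKloosterman (m₁, m₂) (n₁, n₂) d₁ d₂ f = 0 := by
  rw [fineKloosterman_eq_sum _ _ _ _ h₁ h₂ hf, Finset.filter_false_of_mem, Finset.sum_empty,
    mul_zero]
  exact fun p hp hc => h (gcd_eq_gcd_of_mem_inversePairs hp hc)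

/-! ### Decomposition of the coarse sum -/

theorem div_ne_zero_of_mem_divisors_gcd {c₁ c₂ : ℤ} (h₁ : c₁ ≠ 0) (h₂ : c₂ ≠ 0) {f : ℕ}
    (hf : f ∈ (Int.gcd c₁ c₂).divisors) :
    c₁ / f * f = c₁ ∧ c₂ / f * f = c₂ ∧ c₁ / f ≠ 0 ∧ c₂ / f ≠ 0 ∧ 0 < f := by
  have hd : (f : ℤ) ∣ Int.gcd c₁ c₂ := by exact_mod_cast Nat.dvd_of_mem_divisors hf
  have e₁ := Int.ediv_mul_cancel (hd.trans (Int.gcd_dvd_left c₁ c₂))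
  have e₂ := Int.ediv_mul_cancel (hd.trans (Int.gcd_dvd_right c₁ c₂))
  refine ⟨e₁, e₂, fun h => h₁ ?_, fun h => h₂ ?_, Nat.pos_of_mem_divisors hf⟩
  · rw [← e₁, h, zero_mul]
  · rw [← e₂, h, zero_mul]

theorem coarseSet_eq_iUnion {c₁ c₂ : ℤ} (h₁ : c₁ ≠ 0) (h₂ : c₂ ≠ 0) :
    coarseSet c₁ c₂ =
      ⋃ f ∈ ((Int.gcd c₁ c₂).divisors : Set ℕ), fineSet (c₁ / f) (c₂ / f) f := by
  ext A
  simp only [Set.mem_iUnion, exists_prop, mem_coarseSet_iff h₁ h₂, mem_fineSet_iff,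
    Finset.mem_coe]
  constructor
  · rintro ⟨e₁, e₂⟩
    -- The gcd of the two bottom entries divides c₁, which is one of them, and c₂, which is a minor
    -- linear in them.
    have hf : Int.gcd (A 2 0) (A 2 1) ∈ (Int.gcd c₁ c₂).divisors := by
      refine Nat.mem_divisors.2 ⟨Int.dvd_gcd ?_ ?_, by simp [h₁]⟩
      · rw [← e₁]; exact Int.gcd_dvd_left _ _
      · rw [← e₂]
        exact dvd_sub ((Int.gcd_dvd_right _ _).mul_left _) ((Int.gcd_dvd_left _ _).mul_left _)
    obtain ⟨f₁, f₂, -⟩ := div_ne_zero_of_mem_divisors_gcd h₁ h₂ hf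
    exact ⟨_, hf, rfl, e₁.trans f₁.symm, e₂.trans f₂.symm⟩
  · rintro ⟨f, hf, -, e₁, e₂⟩
    obtain ⟨f₁, f₂, -⟩ := div_ne_zero_of_mem_divisors_gcd h₁ h₂ hf
    exact ⟨e₁.trans f₁, e₂.trans f₂⟩

/-- Left translation fixes the bottom row and right translation adds a multiple of A₃₁ to A₃₂; this
makes the pieces for different f disjoint. -/
theorem gcd_eq_of_mk_eq {A B : SpecialLinearGroup (Fin 3) ℤ}
    (h : DoubleCoset.mk GammaInf GammaInf A = DoubleCoset.mk GammaInf GammaInf B) :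
    Int.gcd (A 2 0) (A 2 1) = Int.gcd (B 2 0) (B 2 1) := by
  obtain ⟨a, b, c, x, y, z, rfl⟩ := (mk_eq_mk_iff A B).1 h
  rw [upperUni_mul_mul_apply]
  simp

theorem doubleCosets_coarseSet {c₁ c₂ : ℤ} (h₁ : c₁ ≠ 0) (h₂ : c₂ ≠ 0) :
    doubleCosets (coarseSet c₁ c₂) =
      ⋃ f ∈ ((Int.gcd c₁ c₂).divisors : Set ℕ), doubleCosets (fineSet (c₁ / f) (c₂ / f) f) := by
  simp only [doubleCosets, coarseSet_eq_iUnion h₁ h₂, Set.image_iUnion]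

theorem pairwiseDisjoint_doubleCosets_fineSet (c₁ c₂ : ℤ) (s : Set ℕ) :
    s.PairwiseDisjoint fun f => doubleCosets (fineSet (c₁ / f) (c₂ / f) f) := by
  intro f _ g _ hfg
  refine Set.disjoint_left.2 ?_
  rintro _ ⟨A, hA, rfl⟩ ⟨B, hB, h⟩
  exact hfg ((mem_fineSet_iff.1 hA).1.symm.trans
    ((gcd_eq_of_mk_eq h).symm.trans (mem_fineSet_iff.1 hB).1))

theorem finite_doubleCosets_coarseSet {c₁ c₂ : ℤ} (h₁ : c₁ ≠ 0) (h₂ : c₂ ≠ 0) :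
    (doubleCosets (coarseSet c₁ c₂)).Finite := by
  rw [doubleCosets_coarseSet h₁ h₂]
  refine (Finset.finite_toSet _).biUnion fun f hf => ?_
  obtain ⟨-, -, g₁, g₂, hf⟩ := div_ne_zero_of_mem_divisors_gcd h₁ h₂ hf
  exact finite_doubleCosets_fineSet g₁ g₂ hf

theorem coarseKloosterman_eq_sum_fine (m n : ℤ × ℤ) {c₁ c₂ : ℤ} (h₁ : c₁ ≠ 0) (h₂ : c₂ ≠ 0) :
    coarseKloosterman m n c₁ c₂ =
      ∑ f ∈ (Int.gcd c₁ c₂).divisors, fineKloosterman m n (c₁ / f) (c₂ / f) f := by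
  rw [coarseKloosterman, doubleCosets_coarseSet h₁ h₂,
    finsum_mem_biUnion (pairwiseDisjoint_doubleCosets_fineSet c₁ c₂ _) (Finset.finite_toSet _)
      fun f hf => ?_, finsum_mem_coe_finset]
  · refine Finset.sum_congr rfl fun f hf => ?_
    obtain ⟨f₁, f₂, -⟩ := div_ne_zero_of_mem_divisors_gcd h₁ h₂ hf
    rw [fineKloosterman, f₁, f₂]
  · obtain ⟨-, -, g₁, g₂, hf⟩ := div_ne_zero_of_mem_divisors_gcd h₁ h₂ hf
    exact finite_doubleCosets_fineSet g₁ g₂ hf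

theorem theorem5p10 (m₁ m₂ n₁ n₂ : ℤ) :
    (∀ (d₁ d₂ : ℤ) (f : ℕ), d₁ ≠ 0 → d₂ ≠ 0 → 0 < f →
      (doubleCosets (fineSet d₁ d₂ f)).Finite ∧
      (Int.gcd (m₂ * d₂) f ≠ Int.gcd (n₂ * d₁) f →
        fineKloosterman (m₁, m₂) (n₁, n₂) d₁ d₂ f = 0) ∧
      (Int.gcd (m₂ * d₂) f = Int.gcd (n₂ * d₁) f →
        fineKloosterman (m₁, m₂) (n₁, n₂) d₁ d₂ f =
          f * ∑ p ∈ inversePairs f with m₂ * d₂ + n₂ * d₁ * p.2 ≡ 0 [ZMOD f],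
            kloosterman n₁ ((m₂ * d₂ + n₂ * d₁ * p.2) / f) d₁ *
              kloosterman m₁ ((n₂ * d₁ + m₂ * d₂ * p.1) / f) d₂)) ∧
    (∀ c₁ c₂ : ℤ, c₁ ≠ 0 → c₂ ≠ 0 →
      (doubleCosets (coarseSet c₁ c₂)).Finite ∧
      coarseKloosterman (m₁, m₂) (n₁, n₂) c₁ c₂ =
        ∑ f ∈ (Int.gcd c₁ c₂).divisors,
          fineKloosterman (m₁, m₂) (n₁, n₂) (c₁ / f) (c₂ / f) f ∧
      coarseKloosterman (m₁, m₂) (n₁, n₂) c₁ c₂ =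
        ∑ f ∈ (Int.gcd c₁ c₂).divisors,
          f * ∑ p ∈ inversePairs f with m₂ * (c₂ / f) + n₂ * (c₁ / f) * p.2 ≡ 0 [ZMOD f],
            kloosterman n₁ ((m₂ * (c₂ / f) + n₂ * (c₁ / f) * p.2) / f) (c₁ / f) *
              kloosterman m₁ ((n₂ * (c₁ / f) + m₂ * (c₂ / f) * p.1) / f) (c₂ / f)) := by
  refine ⟨fun d₁ d₂ f h₁ h₂ hf => ⟨finite_doubleCosets_fineSet h₁ h₂ hf,
    fineKloosterman_eq_zero _ _ _ _ h₁ h₂ hf, fun _ => fineKloosterman_eq_sum _ _ _ _ h₁ h₂ hf⟩,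
    fun c₁ c₂ h₁ h₂ => ⟨finite_doubleCosets_coarseSet h₁ h₂,
      coarseKloosterman_eq_sum_fine _ _ h₁ h₂, ?_⟩⟩
  rw [coarseKloosterman_eq_sum_fine _ _ h₁ h₂]
  refine Finset.sum_congr rfl fun f hf => ?_
  obtain ⟨-, -, g₁, g₂, hf⟩ := div_ne_zero_of_mem_divisors_gcd h₁ h₂ hf
  exact fineKloosterman_eq_sum _ _ _ _ g₁ g₂ hf
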